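/- Let $(R,\mathfrak m)$ be a Noetherian local ring and let $I$ be an ideal of $R$ with a minimal generating set $x_1,\dots,x_s,y$ such that $J=(x_1,\dots,x_s)$ is a reduction of $I$. Let $r=\mathrm{r}_J(I)$ be the reduction number, i.e. the least integer $r\ge 0$ with $I^{r+1}=JI^r$. Put $J_0=0$ and $J_i=(x_1,\dots,x_i)$ for $1\le i\le s$. Let $V=R[X_1,\dots,X_s,Y]$, with its standard grading $V=\bigoplus_{n\ge 0}V_n$ (each $V_n$ consists of the forms of degree $n$), let $\varphi:V\to R[It]=\bigoplus_{n\ge0}I^nt^n$ be the $R$-algebra map with $X_i\mapsto x_it$, $Y\mapsto yt$, let $Q=\bigoplus_{n\ge1}Q_n$ be its kernel, and let $Q\langle n\rangle\subseteq Q$ be the ideal generated by the homogeneous elements of $Q$ of degree at most $n$. The relation type $\mathrm{rt}(I)$ is the least integer $N\ge 1$ with $Q=Q\langle N\rangle$. Assume that (a) $x_1,\dots,x_s$ is a $d$-sequence, i.e. $(J_i:x_{i+1}x_j)=(J_i:x_j)$ for all $0\le i\le s-1$ and $i+1\le j\le s$; and (b) the Valabrega–Valla modules $VV_{J_i}(I)_{r+1}=(J_i\cap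 I^{r+1})/J_iI^{r}$ vanish for all $i=1,\dots,s-1$. Then $\mathrm{rt}(I)\le r+1$. Suppose that, in addition, (c) $x_1,\dots,x_s$ is an $R$-sequence; and (d) $VV_{J_i}(I)_{r}=(J_i\cap I^{r})/J_iI^{r-1}=0$ for all $i=1,\dots,s-1$. Then $\mathrm{rt}(I)=r+1$, and there are forms $F_1,\dots,F_s\in V_r$ such that $Y^{r+1}-\sum_{i=1}^sX_iF_i\in Q_{r+1}$ and $$Q=\Bigl(Y^{r+1}-\sum_{i=1}^sX_iF_i\Bigr)+Q\langle r\rangle .$$ -/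

import Mathlib

section

variable {R : Type*} [CommRing R]

/-- `z` is a minimal generating family of the ideal `I`: it generates `I` and no member is
redundant. -/
structure IsMinimalGeneratingFamily {ι : Type*} (z : ι → R) (I : Ideal R) : Prop where
  span_range : Ideal.span (Set.range z) = I
  notMem_span : ∀ i, z i ∉ Ideal.span (z '' {j | j ≠ i})

/-- `J` is a reduction of `I`. -/
def IsReduction (J I : Ideal R) : Prop :=
  J ≤ I ∧ ∃ n : ℕ, I ^ (n + 1) = J * I ^ n

/-- The reduction number `r_J(I)`: the least `r ≥ 0` with `I ^ (r + 1) = J * I ^ r`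
(meaningful when `J` is a reduction of `I`, so that such an `r` exists). -/
noncomputable def reductionNumber (J I : Ideal R) : ℕ :=
  sInf {n : ℕ | I ^ (n + 1) = J * I ^ n}

/-- The ideal `J_i = (x_1, …, x_i)` generated by the first `i` members of `x`; `J_0 = 0`. -/
def initialIdeal {s : ℕ} (x : Fin s → R) (i : ℕ) : Ideal R :=
  Ideal.span (x '' {j : Fin s | (j : ℕ) < i})

/-- `x_1, …, x_s` is a `d`-sequence: `(J_i : x_{i+1} x_j) = (J_i : x_j)` for all
`0 ≤ i ≤ s - 1` and all `j ≥ i + 1`. The element `x_{i+1}` is `x i` with indices from `0`. -/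
def IsDSequence {s : ℕ} (x : Fin s → R) : Prop :=
  ∀ i j : Fin s, i ≤ j →
    (initialIdeal x i).colon {x i * x j} = (initialIdeal x i).colon {x j}

/-- The Valabrega–Valla module `VV_L(I)_n = (L ∩ I ^ n) / (L * I ^ (n - 1))`, for `L ≤ I` and
`n ≥ 1`. -/
abbrev ValabregaVallaModule (L I : Ideal R) (n : ℕ) : Type _ :=
  ↥(L ⊓ I ^ n) ⧸ Submodule.submoduleOf (L * I ^ (n - 1)) (L ⊓ I ^ n)

/-- The polynomial presentation `R[T_i : i ∈ ι] → R[It]` of the Rees algebra of the ideal `I`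
generated by the family `z`, sending `T_i` to `z_i t`. -/
noncomputable def reesPresentation {ι : Type*} (z : ι → R) :
    MvPolynomial ι R →ₐ[R] reesAlgebra (Ideal.span (Set.range z)) :=
  MvPolynomial.aeval fun i =>
    ⟨Polynomial.monomial 1 (z i), reesAlgebra.monomial_mem.mpr
      (by simpa using Ideal.subset_span (Set.mem_range_self i))⟩

/-- The ideal `Q` of equations of the Rees algebra of the ideal generated by `z`. -/
noncomputable def reesEquations {ι : Type*} (z : ι → R) : Ideal (MvPolynomial ι R) :=
  RingHom.ker (reesPresentation z)

/-- The ideal `Q⟨n⟩` generated by the homogeneous equations of degree at most `n`. -/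
noncomputable def reesEquationsUpTo {ι : Type*} (z : ι → R) (n : ℕ) :
    Ideal (MvPolynomial ι R) :=
  Ideal.span {F | F ∈ reesEquations z ∧ ∃ m ≤ n, F.IsHomogeneous m}

/-- The relation type of the ideal generated by `z`: the least `N ≥ 1` with `Q = Q⟨N⟩`
(and `⊤` if there is none). -/
noncomputable def relationType {ι : Type*} (z : ι → R) : ℕ∞ :=
  sInf {N : ℕ∞ | ∃ n : ℕ, N = n ∧ 1 ≤ n ∧ reesEquations z = reesEquationsUpTo z n}

end

/-! ### Colon ideals, Valabrega–Valla conditions and powers of `I` -/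

section Ideals

variable {R : Type*} [CommRing R]

/-! Since `y ^ (r + 1) ∈ J I ^ r`, there is an equation `P = Y ^ (r + 1) - ∑ X_i F_i`. Subtracting a
multiple of `P` from an equation of degree `n + 1 > r` leaves one of the form `∑ X_i G_i`. Its last
coefficient, say that of `X_{k+1}`, takes at `z` a value in `(J_k : x_{k+1}) ∩ I ^ n`. If this
intersection lies in `J_k I ^ (n - 1)`, the coefficient is an equation of degree `n` plus some `∑_{j
≤ k} X_j H_j`, and the sum gets shorter (`sum_mem_reesEquationsUpTo`).

This colon condition holds for `n ≥ r + 1` (`colon_condition_of_le`): there `I ^ n ⊆ J`, a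
`d`-sequence satisfies `(J_k : x_{k+1}) ∩ J = J_k`, and (b) propagates to higher degrees. Hence
`rt(I) ≤ r + 1`. In degree `r`, (c) and (d) give it directly, so `P` is the only new generator in
degree `r + 1`.

For sharpness, `P` is monic in `Y`. Over a local ring, equations generating it include one of the
form `a Y ^ m + ∑ X_i G_i` with `a` a unit, which forces `I ^ m = J I ^ (m - 1)` and so `m > r`. -/

theorem initialIdeal_mono {s : ℕ} (x : Fin s → R) {i j : ℕ} (h : i ≤ j) :
    initialIdeal x i ≤ initialIdeal x j :=
  Ideal.span_mono (Set.image_mono fun _ hk => lt_of_lt_of_le hk h)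

theorem initialIdeal_zero {s : ℕ} (x : Fin s → R) : initialIdeal x 0 = ⊥ := by
  simp [initialIdeal]

theorem initialIdeal_eq_span_range {s : ℕ} (x : Fin s → R) :
    initialIdeal x s = Ideal.span (Set.range x) := by
  simp [initialIdeal]

theorem mem_initialIdeal {s : ℕ} (x : Fin s → R) {j : Fin s} {i : ℕ} (h : (j : ℕ) < i) :
    x j ∈ initialIdeal x i :=
  Ideal.subset_span ⟨j, h, rfl⟩

/-- Elements of `J_k * K` are combinations of `x_1, …, x_k` with coefficients in `K`. -/
theorem exists_sum_of_mem_initialIdeal_mul {s : ℕ} (x : Fin s → R) (k : ℕ) (K : Ideal R) {w : R}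
    (hw : w ∈ initialIdeal x k * K) :
    ∃ h : Fin s → R, (∀ j, h j ∈ K) ∧ (∀ j : Fin s, k ≤ j → h j = 0) ∧ w = ∑ j, x j * h j := by
  induction hw using Submodule.mul_induction_on' with
  | mem_mul_mem m hm n hn =>
    unfold initialIdeal at hm
    induction hm using Submodule.span_induction with
    | mem a ha =>
      obtain ⟨j, hj, rfl⟩ := ha
      refine ⟨Pi.single j n, fun i => ?_, fun i hi => ?_, ?_⟩
      · by_cases h : i = j
        · subst h; simpa using hn
        · simp [h]
      · have : i ≠ j := by rintro rfl; exact absurd hj (not_lt.mpr hi)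
        simp [this]
      · simp [Pi.single_apply]
    | zero => exact ⟨0, by simp, by simp, by simp⟩
    | add a b _ _ iha ihb =>
      obtain ⟨f, hf, hf', rfl'⟩ := iha
      obtain ⟨g, hg, hg', rfl''⟩ := ihb
      refine ⟨f + g, fun j => K.add_mem (hf j) (hg j), fun j hj => by simp [hf' j hj, hg' j hj], ?_⟩
      simp [add_mul, mul_add, Finset.sum_add_distrib, rfl', rfl'']
    | smul c a _ iha =>
      obtain ⟨f, hf, hf', h⟩ := iha
      refine ⟨fun j => c * f j, fun j => K.mul_mem_left _ (hf j),
        fun j hj => by simp [hf' j hj], ?_⟩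
      rw [smul_eq_mul, mul_assoc, h, Finset.mul_sum]
      exact Finset.sum_congr rfl fun j _ => by ring
  | add a _ b _ iha ihb =>
    obtain ⟨f, hf, hf', rfl⟩ := iha
    obtain ⟨g, hg, hg', rfl⟩ := ihb
    exact ⟨f + g, fun j => K.add_mem (hf j) (hg j), fun j hj => by simp [hf' j hj, hg' j hj],
      by simp [mul_add, Finset.sum_add_distrib]⟩

theorem sum_mem_initialIdeal {s : ℕ} (x : Fin s → R) (k : ℕ) (h : Fin s → R)
    (hk : ∀ j : Fin s, k ≤ j → h j = 0) : ∑ j, x j * h j ∈ initialIdeal x k := by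
  refine Ideal.sum_mem _ fun j _ => ?_
  by_cases hj : k ≤ j
  · simp [hk j hj]
  · exact Ideal.mul_mem_right _ _ (mem_initialIdeal x (not_le.mp hj))

theorem sum_mul_eq_add_sum_update {ι A : Type*} [Fintype ι] [DecidableEq ι] [CommSemiring A]
    (x a : ι → A) (t : ι) :
    ∑ j, x j * a j = x t * a t + ∑ j, x j * Function.update a t 0 j := by
  rw [← Finset.add_sum_erase _ _ (Finset.mem_univ t),
    ← Finset.add_sum_erase _ (fun j => x j * Function.update a t 0 j) (Finset.mem_univ t)]
  simp only [Function.update_self, mul_zero, zero_add]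
  congr 1
  refine Finset.sum_congr rfl fun j hj => ?_
  rw [Function.update_of_ne (Finset.ne_of_mem_erase hj)]

/-- For a `d`-sequence, `(J_i : x_{i+1}) ∩ J = J_i`. -/
theorem IsDSequence.mem_initialIdeal_of_mul_mem {s : ℕ} {x : Fin s → R} (hx : IsDSequence x)
    (i : Fin s) {w : R} (hw : w ∈ Ideal.span (Set.range x)) (h : x i * w ∈ initialIdeal x i) :
    w ∈ initialIdeal x i := by
  have key : ∀ t : Fin s, i ≤ t → x t * w ∈ initialIdeal x i := by
    intro t ht
    have h1 : w ∈ (initialIdeal x i).colon {x i * x t} := by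
      rw [Submodule.mem_colon_singleton, smul_eq_mul]
      have := Ideal.mul_mem_left _ (x t) h
      convert this using 1; ring
    rw [hx i t ht, Submodule.mem_colon_singleton, smul_eq_mul] at h1
    rwa [mul_comm]
  have desc : ∀ t : ℕ, (i : ℕ) ≤ t → t ≤ s → w ∈ initialIdeal x t → w ∈ initialIdeal x i := by
    intro t hit
    induction t, hit using Nat.le_induction with
    | base => exact fun _ h => h
    | succ t hit ih =>
      intro hts hwt
      refine ih (by omega) ?_
      rw [← Ideal.mul_top (initialIdeal x (t + 1))] at hwt
      obtain ⟨a, -, ha, hwa⟩ := exists_sum_of_mem_initialIdeal_mul x _ _ hwt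
      let T : Fin s := ⟨t, hts⟩
      have hT : x T * w ∈ initialIdeal x T := initialIdeal_mono x hit (key T hit)
      have hsplit : w = x T * a T + ∑ j, x j * Function.update a T 0 j := by
        rw [hwa, sum_mul_eq_add_sum_update x a T]
      have hrest : ∑ j, x j * Function.update a T 0 j ∈ initialIdeal x T := by
        refine sum_mem_initialIdeal x _ _ fun j hj => ?_
        by_cases hjT : j = T
        · simp [hjT]
        · rw [Function.update_of_ne hjT]
          refine ha j ?_
          have : (j : ℕ) ≠ t := fun h => hjT (Fin.ext h)
          have : t ≤ (j : ℕ) := hj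
          omega
      -- The condition at the pair `(T, T)` reduces `x_T ^ 2 a_T ∈ J_T` to `x_T a_T ∈ J_T`, so `w`
      -- descends one step in the chain of the `J_t`.
      have h2 : a T ∈ (initialIdeal x T).colon {x T * x T} := by
        rw [Submodule.mem_colon_singleton, smul_eq_mul]
        have := Ideal.sub_mem _ hT (Ideal.mul_mem_left _ (x T) hrest)
        convert this using 1
        linear_combination (-x T) * hsplit
      rw [hx T T le_rfl, Submodule.mem_colon_singleton, smul_eq_mul, mul_comm] at h2
      rw [hsplit]
      exact Ideal.add_mem _ h2 hrest
  exact desc s i.2.le le_rfl (by rwa [initialIdeal_eq_span_range])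

/-- Unlike the `d`-sequence version, this does not ask that `w ∈ J`, so it applies in degree `r`,
where `I ^ r` need not lie in `J`. -/
theorem mem_initialIdeal_of_mul_mem_of_isWeaklyRegular {s : ℕ} {x : Fin s → R}
    (hx : RingTheory.Sequence.IsWeaklyRegular R (List.ofFn x)) (i : Fin s) {w : R}
    (h : x i * w ∈ initialIdeal x i) : w ∈ initialIdeal x i := by
  have hreg := hx.regular_mod_prev i (by simp)
  have hid : (Ideal.ofList ((List.ofFn x).take i) • ⊤ : Submodule R R) = initialIdeal x i := by
    rw [smul_eq_mul, Ideal.mul_top]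
    unfold Ideal.ofList initialIdeal
    congr 1
    ext a
    simp only [List.mem_take_iff_getElem, List.getElem_ofFn, Set.mem_ofPred_eq, Set.mem_image,
      List.length_ofFn]
    constructor
    · rintro ⟨j, hj, rfl⟩
      exact ⟨⟨j, by omega⟩, by simp; omega, rfl⟩
    · rintro ⟨j, hj, rfl⟩
      exact ⟨j, by simp only [lt_min_iff]; exact ⟨hj, j.2⟩, rfl⟩
  rw [hid] at hreg
  simp only [List.getElem_ofFn, Fin.eta] at hreg
  rw [← Submodule.Quotient.mk_eq_zero]
  apply hreg
  simp only [smul_zero]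
  rw [← Submodule.Quotient.mk_smul, Submodule.Quotient.mk_eq_zero]
  exact h

theorem subsingleton_valabregaVallaModule_iff {L I : Ideal R} {n : ℕ} :
    Subsingleton (ValabregaVallaModule L I n) ↔ L ⊓ I ^ n ≤ L * I ^ (n - 1) := by
  rw [Submodule.Quotient.subsingleton_iff, Submodule.submoduleOf_eq_top]

/-- If `I ^ (m + 1) = J * I ^ m` and the colon condition
`(J_k : x_{k+1}) ∩ I ^ m ⊆ J_k I ^ (m - 1)` holds for all `k`, then `J_i ∩ I ^ (m + 1) ⊆ J_i I ^ m`
for all `i`. -/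
theorem initialIdeal_inf_pow_le {s : ℕ} {x : Fin s → R} {I : Ideal R}
    (hJI : Ideal.span (Set.range x) ≤ I) {m : ℕ} (hm : 1 ≤ m)
    (hred : I ^ (m + 1) = Ideal.span (Set.range x) * I ^ m)
    (hcolon : ∀ k : Fin s, ∀ w ∈ I ^ m, x k * w ∈ initialIdeal x k →
      w ∈ initialIdeal x k * I ^ (m - 1)) (i : ℕ) :
    initialIdeal x i ⊓ I ^ (m + 1) ≤ initialIdeal x i * I ^ m := by
  rintro w ⟨hwi, hwI⟩
  replace hwI : w ∈ I ^ (m + 1) := hwI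
  -- Descent from `w ∈ J I ^ m`: while `t ≥ i`, the term `x_T a_T` lies in `J_t` because `w` and the
  -- other terms do, so the colon condition applies to `a_T`.
  have desc : ∀ t : ℕ, t ≤ s → w ∈ initialIdeal x t * I ^ m → w ∈ initialIdeal x i * I ^ m := by
    intro t
    induction t with
    | zero => exact fun _ h => Ideal.mul_mono_left (initialIdeal_mono x (Nat.zero_le i)) h
    | succ t ih =>
      intro hts hwt
      by_cases hti : t + 1 ≤ i
      · exact Ideal.mul_mono_left (initialIdeal_mono x hti) hwt
      refine ih (by omega) ?_
      obtain ⟨a, haI, ha, hwa⟩ := exists_sum_of_mem_initialIdeal_mul x _ _ hwt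
      let T : Fin s := ⟨t, hts⟩
      rw [← Finset.add_sum_erase _ _ (Finset.mem_univ T)] at hwa
      have hrest : ∑ j ∈ Finset.univ.erase T, x j * a j ∈ initialIdeal x t * I ^ m := by
        refine Ideal.sum_mem _ fun j hj => ?_
        have hne : (j : ℕ) ≠ t := fun h => Finset.ne_of_mem_erase hj (Fin.ext h)
        by_cases hjt : t + 1 ≤ j
        · simp [ha j hjt]
        · exact Ideal.mul_mem_mul (mem_initialIdeal x (by omega)) (haI j)
      have hT : x T * a T ∈ initialIdeal x T := by
        have h1 : w ∈ initialIdeal x t := initialIdeal_mono x (by omega) hwi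
        have := Ideal.sub_mem _ h1 (Ideal.mul_le_left hrest)
        rwa [hwa, add_sub_cancel_right] at this
      have h2 := hcolon T _ (haI T) hT
      rw [hwa]
      refine Ideal.add_mem _ ?_ hrest
      have h3 := Ideal.mul_mem_mul (hJI (Ideal.subset_span ⟨T, rfl⟩)) h2
      rw [mul_left_comm, ← pow_succ', Nat.sub_add_cancel hm] at h3
      exact h3
  refine desc s le_rfl ?_
  rwa [initialIdeal_eq_span_range, ← hred]

/-- The colon condition `(J_k : x_{k+1}) ∩ I ^ m ⊆ J_k I ^ (m - 1)` holds in all degrees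
`m ≥ r + 1` if the Valabrega–Valla modules vanish in degree `r + 1`. -/
theorem colon_condition_of_le {s : ℕ} {x : Fin s → R} {I : Ideal R}
    (hx : IsDSequence x) (hJI : Ideal.span (Set.range x) ≤ I) {r : ℕ}
    (hred : I ^ (r + 1) = Ideal.span (Set.range x) * I ^ r)
    (hb : ∀ i : ℕ, 1 ≤ i → i < s → initialIdeal x i ⊓ I ^ (r + 1) ≤ initialIdeal x i * I ^ r)
    {m : ℕ} (hm : r + 1 ≤ m) (k : Fin s) {w : R} (hw : w ∈ I ^ m)
    (hkw : x k * w ∈ initialIdeal x k) : w ∈ initialIdeal x k * I ^ (m - 1) := by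
  have hredm : ∀ m, r + 1 ≤ m → I ^ m = Ideal.span (Set.range x) * I ^ (m - 1) := by
    intro m hm
    obtain ⟨n, rfl⟩ := Nat.exists_eq_add_of_le hm
    rw [pow_add, hred, mul_assoc, ← pow_add]
    congr 2; omega
  -- For `m ≥ r + 1` the power `I ^ m` lies in `J`, as the `d`-sequence property requires.
  have hmem : ∀ m, r + 1 ≤ m → ∀ k : Fin s, ∀ w ∈ I ^ m, x k * w ∈ initialIdeal x k →
      w ∈ initialIdeal x k := fun m hm k w hw hkw =>
    hx.mem_initialIdeal_of_mul_mem k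
      (Ideal.mul_le_left (hredm m hm ▸ hw : w ∈ Ideal.span (Set.range x) * I ^ (m - 1))) hkw
  induction m, hm using Nat.le_induction generalizing k w with
  | base =>
    have hwk := hmem _ le_rfl k w hw hkw
    rcases Nat.eq_zero_or_pos (k : ℕ) with h0 | h0
    · rw [h0, initialIdeal_zero] at hwk
      rw [(Submodule.mem_bot R).mp hwk]
      exact Ideal.zero_mem _
    · exact hb k h0 k.2 ⟨hwk, hw⟩
  | succ m hm ih =>
    exact initialIdeal_inf_pow_le hJI (by omega) (hredm (m + 1) (by omega))
      (fun k w hw hkw => ih k hw hkw) k ⟨hmem _ (by omega) k w hw hkw, hw⟩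

/-- Only the power of `y` avoids the factor `J`; thus `y ^ (n + 1) ∈ J I ^ n` already gives `I ^ (n
+ 1) = J I ^ n`. -/
theorem sup_span_singleton_pow_succ (J : Ideal R) (y : R) (n : ℕ) :
    (J ⊔ Ideal.span {y}) ^ (n + 1) = J * (J ⊔ Ideal.span {y}) ^ n ⊔ Ideal.span {y ^ (n + 1)} := by
  apply le_antisymm
  · induction n with
    | zero => simp
    | succ n ih =>
      conv_lhs => rw [pow_succ', Ideal.sup_mul]
      refine sup_le le_sup_left ?_
      refine (Ideal.mul_mono_right ih).trans ?_
      rw [Ideal.mul_sup, Ideal.span_singleton_mul_span_singleton, ← pow_succ']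
      refine sup_le_sup_right ?_ _
      rw [mul_left_comm]
      refine Ideal.mul_mono_right ?_
      rw [pow_succ']
      exact Ideal.mul_mono_left le_sup_right
  · refine sup_le ?_ ?_
    · rw [pow_succ']
      exact Ideal.mul_mono_left le_sup_left
    · rw [Ideal.span_singleton_le_iff_mem]
      exact Ideal.pow_mem_pow (le_sup_right (a := J) (Ideal.mem_span_singleton_self y)) _

theorem span_range_eq_sup {s : ℕ} (z : Fin (s + 1) → R) :
    Ideal.span (Set.range z) =
      Ideal.span (Set.range fun i : Fin s => z i.castSucc) ⊔ Ideal.span {z (Fin.last s)} := by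
  rw [← Ideal.span_union]
  congr 1
  ext a
  simp [Fin.exists_fin_succ', eq_comm, or_comm]

end Ideals

/-! ### Equations of the Rees algebra -/

section Equations

open MvPolynomial

variable {R : Type*} [CommRing R]

theorem coe_reesPresentation {ι : Type*} (z : ι → R) (F : MvPolynomial ι R) :
    (reesPresentation z F : Polynomial R) = aeval (fun i => Polynomial.monomial 1 (z i)) F := by
  unfold reesPresentation
  rw [← Subalgebra.coe_val, ← AlgHom.comp_apply, comp_aeval]
  rfl

/-- A form of degree `n` maps to its value at `z` times `t ^ n`. Hence `Q` is homogeneous, and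
membership is tested by evaluation. -/
theorem coeff_reesPresentation {ι : Type*} (z : ι → R) (F : MvPolynomial ι R) (n : ℕ) :
    (reesPresentation z F : Polynomial R).coeff n = eval z (homogeneousComponent n F) := by
  rw [coe_reesPresentation]
  induction F using MvPolynomial.induction_on' with
  | monomial d a =>
    have h1 : aeval (fun i => Polynomial.monomial 1 (z i)) (monomial d a)
        = Polynomial.monomial d.degree (eval z (monomial d a)) := by
      rw [aeval_monomial, eval_monomial]
      have h2 : ∀ i, Polynomial.monomial 1 (z i) = Polynomial.C (z i) * Polynomial.X := fun i =>
        Polynomial.C_mul_X_eq_monomial.symm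
      rw [← Polynomial.C_mul_X_pow_eq_monomial]
      simp only [h2, mul_pow, Finsupp.prod, Finset.prod_mul_distrib, Finset.prod_pow_eq_pow_sum,
        Finsupp.degree_apply, map_mul, map_prod, map_pow, Polynomial.algebraMap_eq, mul_assoc]
    rw [h1, Polynomial.coeff_monomial, homogeneousComponent_of_mem
      ((mem_homogeneousSubmodule _ _).mpr (isHomogeneous_monomial a rfl))]
    by_cases hn : d.degree = n
    · rw [if_pos hn, if_pos hn.symm]
    · rw [if_neg hn, if_neg (Ne.symm hn), map_zero]
  | add p q hp hq => simp [hp, hq]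

theorem mem_reesEquations_iff {ι : Type*} {z : ι → R} {F : MvPolynomial ι R} :
    F ∈ reesEquations z ↔ ∀ n, eval z (homogeneousComponent n F) = 0 := by
  rw [reesEquations, RingHom.mem_ker, ← Subalgebra.coe_eq_zero, Polynomial.ext_iff]
  simp [coeff_reesPresentation]

theorem MvPolynomial.IsHomogeneous.mem_reesEquations_iff {ι : Type*} {z : ι → R}
    {F : MvPolynomial ι R} {n : ℕ} (hF : F.IsHomogeneous n) :
    F ∈ reesEquations z ↔ eval z F = 0 := by
  rw [_root_.mem_reesEquations_iff]
  constructor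
  · intro h
    rw [← h n, homogeneousComponent_eq_self ((mem_homogeneousSubmodule _ _).mpr hF)]
  · intro h m
    rw [homogeneousComponent_of_mem ((mem_homogeneousSubmodule _ _).mpr hF)]
    split_ifs
    · exact h
    · simp

theorem homogeneousComponent_mem_reesEquations {ι : Type*} {z : ι → R} {F : MvPolynomial ι R}
    (hF : F ∈ reesEquations z) (n : ℕ) : homogeneousComponent n F ∈ reesEquations z :=
  (homogeneousComponent_isHomogeneous n F).mem_reesEquations_iff.mpr (mem_reesEquations_iff.mp hF n)

theorem MvPolynomial.IsHomogeneous.mem_reesEquationsUpTo {ι : Type*} {z : ι → R}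
    {F : MvPolynomial ι R} {m n : ℕ} (hF : F.IsHomogeneous m) (hmn : m ≤ n)
    (h : F ∈ reesEquations z) : F ∈ reesEquationsUpTo z n :=
  Ideal.subset_span ⟨h, m, hmn, hF⟩

theorem reesEquationsUpTo_le {ι : Type*} (z : ι → R) (n : ℕ) :
    reesEquationsUpTo z n ≤ reesEquations z :=
  Ideal.span_le.mpr fun _ h => h.1

theorem reesEquations_le_upTo {ι : Type*} {z : ι → R} {N : ℕ}
    (hstep : ∀ n, N ≤ n → ∀ F : MvPolynomial ι R, F.IsHomogeneous (n + 1) → F ∈ reesEquations z →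
      F ∈ reesEquationsUpTo z n) :
    reesEquations z ≤ reesEquationsUpTo z N := by
  have hle : ∀ m, N ≤ m → reesEquationsUpTo z m ≤ reesEquationsUpTo z N := by
    intro m hm
    induction m, hm using Nat.le_induction with
    | base => exact le_rfl
    | succ m hm ih =>
      refine Ideal.span_le.mpr ?_
      rintro F ⟨hFQ, k, hk, hFk⟩
      rcases Nat.lt_or_ge m k with h | h
      · obtain rfl : k = m + 1 := by omega
        exact ih (hstep m hm F hFk hFQ)
      · exact ih (hFk.mem_reesEquationsUpTo h hFQ)
  intro F hF
  rw [← sum_homogeneousComponent F]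
  -- The maximum covers components of degree below `N`.
  refine Ideal.sum_mem _ fun i _ => hle (max i N) (le_max_right _ _) ?_
  exact (homogeneousComponent_isHomogeneous i F).mem_reesEquationsUpTo (le_max_left _ _)
    (homogeneousComponent_mem_reesEquations hF i)

theorem MvPolynomial.IsHomogeneous.exists_eq_add_sum {s n : ℕ} {F : MvPolynomial (Fin (s + 1)) R}
    (hF : F.IsHomogeneous (n + 1)) :
    ∃ (a : R) (G : Fin s → MvPolynomial (Fin (s + 1)) R), (∀ i, (G i).IsHomogeneous n) ∧
      F = C a * X (Fin.last s) ^ (n + 1) + ∑ i, X i.castSucc * G i := by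
  rw [F.as_sum]
  refine Finset.sum_induction _ (fun F => ∃ (a : R) (G : Fin s → MvPolynomial (Fin (s + 1)) R),
    (∀ i, (G i).IsHomogeneous n) ∧
      F = C a * X (Fin.last s) ^ (n + 1) + ∑ i, X i.castSucc * G i) ?_ ?_ ?_
  · rintro _ _ ⟨a, G, hG, rfl⟩ ⟨b, H, hH, rfl⟩
    refine ⟨a + b, fun i => G i + H i, fun i => (hG i).add (hH i), ?_⟩
    simp only [mul_add, Finset.sum_add_distrib, C_add]
    ring
  · exact ⟨0, 0, fun _ => isHomogeneous_zero _ _ _, by simp⟩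
  · intro d hd
    have hdeg : d.degree = n + 1 := by
      by_contra h
      exact mem_support_iff.mp hd (hF.coeff_eq_zero h)
    by_cases hi : ∃ i : Fin s, d i.castSucc ≠ 0
    · obtain ⟨i, hi⟩ := hi
      have hle : Finsupp.single i.castSucc 1 ≤ d :=
        Finsupp.single_le_iff.mpr (Nat.one_le_iff_ne_zero.mpr hi)
      have hd' := add_tsub_cancel_of_le hle
      refine ⟨0, Pi.single i (monomial (d - Finsupp.single i.castSucc 1) (coeff d F)),
        fun j => ?_, ?_⟩
      · by_cases hj : j = i
        · subst hj
          rw [Pi.single_eq_same]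
          refine isHomogeneous_monomial _ ?_
          have := congrArg Finsupp.degree hd'
          rw [map_add, Finsupp.degree_single, hdeg] at this
          omega
        · rw [Pi.single_eq_of_ne hj]
          exact isHomogeneous_zero _ _ _
      · rw [Finset.sum_eq_single i (fun j _ hj => by rw [Pi.single_eq_of_ne hj, mul_zero])
          (by simp), Pi.single_eq_same, X.eq_1 i.castSucc, monomial_mul, hd',
          one_mul, C_0, zero_mul, zero_add]
    · push Not at hi
      have hdl : d = Finsupp.single (Fin.last s) (n + 1) := by
        have hdl : d = Finsupp.single (Fin.last s) (d (Fin.last s)) := by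
          ext j
          refine Fin.lastCases ?_ (fun j => ?_) j
          · simp
          · simp [hi j, (Fin.castSucc_lt_last j).ne]
        rw [hdl, Finsupp.degree_single] at hdeg
        rw [hdl, hdeg]
      refine ⟨coeff d F, 0, fun _ => isHomogeneous_zero _ _ _, ?_⟩
      conv_lhs => rw [hdl]
      rw [C_mul_X_pow_eq_monomial]
      simp [← hdl]

/-- If the colon condition `(J_k : x_{k+1}) ∩ I ^ n ⊆ J_k I ^ (n - 1)` holds, then the equations of
degree `n + 1` lying in `(X_1, …, X_s)` are generated by equations of degree `n`. -/
theorem sum_mem_reesEquationsUpTo {s n : ℕ} {z : Fin (s + 1) → R} (hn : 1 ≤ n)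
    (hcolon : ∀ k : Fin s, ∀ w ∈ Ideal.span (Set.range z) ^ n,
      z k.castSucc * w ∈ initialIdeal (fun i : Fin s => z i.castSucc) k →
      w ∈ initialIdeal (fun i : Fin s => z i.castSucc) k * Ideal.span (Set.range z) ^ (n - 1))
    (G : Fin s → MvPolynomial (Fin (s + 1)) R) (hG : ∀ i, (G i).IsHomogeneous n)
    (hQ : ∑ i, X i.castSucc * G i ∈ reesEquations z) :
    ∑ i, X i.castSucc * G i ∈ reesEquationsUpTo z n := by
  have main : ∀ k : ℕ, k ≤ s → ∀ G : Fin s → MvPolynomial (Fin (s + 1)) R,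
      (∀ i, (G i).IsHomogeneous n) → (∀ i : Fin s, k ≤ i → G i = 0) →
      ∑ i, X i.castSucc * G i ∈ reesEquations z →
      ∑ i, X i.castSucc * G i ∈ reesEquationsUpTo z n := by
    intro k
    induction k with
    | zero =>
      intro _ G _ h0 _
      simp [h0]
    | succ k ih =>
      intro hk G hG h0 hQ
      let K : Fin s := ⟨k, hk⟩
      have hhom : (∑ i : Fin s, X i.castSucc * G i).IsHomogeneous (1 + n) :=
        IsHomogeneous.sum _ _ _ fun i _ => (isHomogeneous_X R _).mul (hG i)
      have hev := hhom.mem_reesEquations_iff.mp hQ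
      simp only [map_sum, map_mul, eval_X] at hev
      rw [← Finset.add_sum_erase _ (fun i : Fin s => z i.castSucc * eval z (G i))
        (Finset.mem_univ K)] at hev
      have hGK : eval z (G K) ∈ Ideal.span (Set.range z) ^ n :=
        (Ideal.mem_span_pow_iff_exists_isHomogeneous z _).mpr ⟨_, hG K, rfl⟩
      have hmem : z K.castSucc * eval z (G K) ∈ initialIdeal (fun i : Fin s => z i.castSucc) K := by
        rw [eq_neg_of_add_eq_zero_left hev]
        refine Ideal.neg_mem_iff _ |>.mpr (Ideal.sum_mem _ fun j hj => ?_)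
        have hne : (j : ℕ) ≠ k := fun h => Finset.ne_of_mem_erase hj (Fin.ext h)
        by_cases hjt : k + 1 ≤ j
        · simp [h0 j hjt]
        · exact Ideal.mul_mem_right _ _
            (mem_initialIdeal (fun i : Fin s => z i.castSucc) (show (j : ℕ) < k by omega))
      obtain ⟨h, hhI, hh0, hsum⟩ := exists_sum_of_mem_initialIdeal_mul _ _ _ (hcolon K _ hGK hmem)
      -- The lifts vanish from index `K` on, so the correction creates no new terms there.
      have hex : ∀ j, ∃ H : MvPolynomial (Fin (s + 1)) R, H.IsHomogeneous (n - 1) ∧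
          eval z H = h j ∧ ((K : ℕ) ≤ j → H = 0) := by
        intro j
        by_cases hj : (K : ℕ) ≤ j
        · exact ⟨0, isHomogeneous_zero _ _ _, by simp [hh0 j hj], fun _ => rfl⟩
        · obtain ⟨H, hH, hHe⟩ := (Ideal.mem_span_pow_iff_exists_isHomogeneous z _).mp (hhI j)
          exact ⟨H, hH, hHe, fun h => absurd h hj⟩
      choose H hH hHe hH0 using hex
      have hXH : ∀ i j, (X i * H j).IsHomogeneous n := fun i j => by
        have := (isHomogeneous_X R i).mul (hH j)
        rwa [Nat.add_sub_cancel' hn] at this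
      have hE : (G K - ∑ j, X j.castSucc * H j).IsHomogeneous n :=
        (hG K).sub (IsHomogeneous.sum _ _ _ fun j _ => hXH _ j)
      have hEQ : G K - ∑ j, X j.castSucc * H j ∈ reesEquations z := by
        rw [hE.mem_reesEquations_iff]
        simp [hHe, hsum]
      -- The product `X_K X_j H_j` is charged to `X_j`, with `j < K`.
      let G' : Fin s → MvPolynomial (Fin (s + 1)) R := fun j =>
        Function.update G K 0 j + X K.castSucc * H j
      have hsplit : ∑ i, X i.castSucc * G i =
          X K.castSucc * (G K - ∑ j, X j.castSucc * H j) + ∑ i, X i.castSucc * G' i := by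
        have e1 : ∑ i, X i.castSucc * G' i = ∑ i, X i.castSucc * Function.update G K 0 i
            + X K.castSucc * ∑ j, X j.castSucc * H j := by
          rw [Finset.mul_sum, ← Finset.sum_add_distrib]
          exact Finset.sum_congr rfl fun j _ => by simp only [G']; ring
        have e2 : ∑ i, X i.castSucc * G i = X K.castSucc * G K +
            ∑ i, X i.castSucc * Function.update G K 0 i :=
          sum_mul_eq_add_sum_update (fun i : Fin s => X i.castSucc) G K
        rw [e1, e2]; ring
      have hQ' : ∑ i, X i.castSucc * G' i ∈ reesEquations z := by
        rw [← add_sub_cancel_left (X K.castSucc * (G K - ∑ j, X j.castSucc * H j))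
          (∑ i, X i.castSucc * G' i), ← hsplit]
        exact Ideal.sub_mem _ hQ (Ideal.mul_mem_left _ _ hEQ)
      rw [hsplit]
      refine Ideal.add_mem _ (Ideal.mul_mem_left _ _ (hE.mem_reesEquationsUpTo le_rfl hEQ))
        (ih (by omega) G' (fun i => ?_) (fun i hi => ?_) hQ')
      · refine IsHomogeneous.add ?_ (hXH _ i)
        by_cases hi : i = K
        · subst hi
          simpa using isHomogeneous_zero _ _ _
        · rw [Function.update_of_ne hi]
          exact hG i
      · simp only [G', hH0 i hi, mul_zero, add_zero]
        by_cases hiK : i = K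
        · simp [hiK]
        · rw [Function.update_of_ne hiK]
          refine h0 i ?_
          have : (i : ℕ) ≠ k := fun h => hiK (Fin.ext h)
          omega
  exact main s le_rfl G hG (fun i hi => absurd i.2 (not_lt.mpr hi)) hQ

/-- The expected equation `Y ^ (r + 1) - ∑ X_i F_i` attached to `I ^ (r + 1) = J * I ^ r`. -/
theorem exists_pow_sub_sum_mem_reesEquations {s r : ℕ} {z : Fin (s + 1) → R}
    (hred : Ideal.span (Set.range z) ^ (r + 1) =
      Ideal.span (Set.range fun i : Fin s => z i.castSucc) * Ideal.span (Set.range z) ^ r) :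
    ∃ F : Fin s → MvPolynomial (Fin (s + 1)) R, (∀ i, (F i).IsHomogeneous r) ∧
      (X (Fin.last s) ^ (r + 1) - ∑ i : Fin s, X i.castSucc * F i).IsHomogeneous (r + 1) ∧
      X (Fin.last s) ^ (r + 1) - ∑ i : Fin s, X i.castSucc * F i ∈ reesEquations z := by
  have hy : z (Fin.last s) ^ (r + 1) ∈ Ideal.span (Set.range z) ^ (r + 1) :=
    Ideal.pow_mem_pow (Ideal.subset_span (Set.mem_range_self _)) _
  rw [hred, ← initialIdeal_eq_span_range] at hy
  obtain ⟨h, hhI, -, hsum⟩ := exists_sum_of_mem_initialIdeal_mul _ _ _ hy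
  choose F hF hFe using fun j => (Ideal.mem_span_pow_iff_exists_isHomogeneous z _).mp (hhI j)
  have hhom : (X (Fin.last s) ^ (r + 1) - ∑ i : Fin s, X i.castSucc * F i).IsHomogeneous
      (r + 1) := by
    refine IsHomogeneous.sub (isHomogeneous_X_pow _ _) (IsHomogeneous.sum _ _ _ fun i _ => ?_)
    rw [add_comm r 1]
    exact (isHomogeneous_X R _).mul (hF i)
  refine ⟨F, hF, hhom, hhom.mem_reesEquations_iff.mpr ?_⟩
  simp [hFe, hsum]

/-- Under the colon condition in degree `n ≥ r`, the equations of degree `n + 1` are generated by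
those of degree `n` and the expected equation `Y ^ (r + 1) - ∑ X_i F_i`. -/
theorem mem_span_sup_reesEquationsUpTo {s n r : ℕ} {z : Fin (s + 1) → R} (hn : 1 ≤ n)
    (hrn : r ≤ n)
    (hcolon : ∀ k : Fin s, ∀ w ∈ Ideal.span (Set.range z) ^ n,
      z k.castSucc * w ∈ initialIdeal (fun i : Fin s => z i.castSucc) k →
      w ∈ initialIdeal (fun i : Fin s => z i.castSucc) k * Ideal.span (Set.range z) ^ (n - 1))
    {E : Fin s → MvPolynomial (Fin (s + 1)) R} (hE : ∀ i, (E i).IsHomogeneous r)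
    (hEQ : X (Fin.last s) ^ (r + 1) - ∑ i : Fin s, X i.castSucc * E i ∈ reesEquations z)
    {F : MvPolynomial (Fin (s + 1)) R} (hF : F.IsHomogeneous (n + 1)) (hFQ : F ∈ reesEquations z) :
    F ∈ Ideal.span {X (Fin.last s) ^ (r + 1) - ∑ i : Fin s, X i.castSucc * E i} ⊔
      reesEquationsUpTo z n := by
  obtain ⟨a, G, hG, hFG⟩ := hF.exists_eq_add_sum
  set P := X (Fin.last s) ^ (r + 1) - ∑ i : Fin s, X i.castSucc * E i with hP
  -- The multiple `a Y ^ (n - r) P` cancels the pure power of `Y`.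
  have hsplit : F = C a * X (Fin.last s) ^ (n - r) * P +
      ∑ i, X i.castSucc * (G i + C a * X (Fin.last s) ^ (n - r) * E i) := by
    have e1 : ∑ i, X i.castSucc * (G i + C a * X (Fin.last s) ^ (n - r) * E i) =
        ∑ i, X i.castSucc * G i +
          C a * X (Fin.last s) ^ (n - r) * ∑ i : Fin s, X i.castSucc * E i := by
      rw [Finset.mul_sum, ← Finset.sum_add_distrib]
      exact Finset.sum_congr rfl fun j _ => by ring
    have e2 : (X (Fin.last s) : MvPolynomial (Fin (s + 1)) R) ^ (n + 1) =
        X (Fin.last s) ^ (n - r) * X (Fin.last s) ^ (r + 1) := by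
      rw [← pow_add]; congr 1; omega
    rw [hFG, e1, hP, e2]; ring
  have hQ : ∑ i, X i.castSucc * (G i + C a * X (Fin.last s) ^ (n - r) * E i) ∈
      reesEquations z := by
    have := Ideal.sub_mem _ hFQ (Ideal.mul_mem_left _ (C a * X (Fin.last s) ^ (n - r)) hEQ)
    rwa [hsplit, add_sub_cancel_left] at this
  rw [hsplit]
  refine Ideal.add_mem _ (Ideal.mem_sup_left (Ideal.mul_mem_left _ _
    (Ideal.mem_span_singleton_self _))) (Ideal.mem_sup_right
      (sum_mem_reesEquationsUpTo hn hcolon _ (fun i => (hG i).add ?_) hQ))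
  have := (isHomogeneous_C_mul_X_pow a (Fin.last s) (n - r)).mul (hE i)
  rwa [Nat.sub_add_cancel hrn] at this

/-- If the equations of degree at most `n` generate one that is monic in `Y`, then `n` exceeds the
reduction number. -/
theorem lt_of_pow_sub_sum_mem_reesEquationsUpTo [IsLocalRing R] {s n d : ℕ}
    {z : Fin (s + 1) → R} {E : Fin s → MvPolynomial (Fin (s + 1)) R}
    (hE : X (Fin.last s) ^ d - ∑ i : Fin s, X i.castSucc * E i ∈ reesEquationsUpTo z n) :
    reductionNumber (Ideal.span (Set.range fun i : Fin s => z i.castSucc))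
      (Ideal.span (Set.range z)) < n := by
  -- Setting `X_i = 0` and `Y = 1` modulo the maximal ideal sends the monic equation to `1`, so some
  -- generator survives; its coefficient of the pure power of `Y` is a unit.
  let ψ : MvPolynomial (Fin (s + 1)) R →+* IsLocalRing.ResidueField R :=
    eval₂Hom (IsLocalRing.residue R) (Fin.snoc (α := fun _ => _) (fun _ => 0) 1)
  have hψC : ∀ a, ψ (C a) = IsLocalRing.residue R a := fun a => by simp [ψ]
  have hψX : ∀ i : Fin s, ψ (X i.castSucc) = 0 := fun i => by simp [ψ]
  have hψY : ψ (X (Fin.last s)) = 1 := by simp [ψ]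
  have hex : ∃ H ∈ {F | F ∈ reesEquations z ∧ ∃ m ≤ n, F.IsHomogeneous m}, ψ H ≠ 0 := by
    by_contra! hall
    have hle : reesEquationsUpTo z n ≤ RingHom.ker ψ := Ideal.span_le.mpr hall
    have := hle hE
    simp [RingHom.mem_ker, hψX, hψY] at this
  obtain ⟨H, ⟨hHQ, m, hm, hHm⟩, hH⟩ := hex
  have hev := hHm.mem_reesEquations_iff.mp hHQ
  cases m with
  | zero =>
    have hC := totalDegree_eq_zero_iff_eq_C.mp ((totalDegree_zero_iff_isHomogeneous _).mpr hHm)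
    rw [hC, eval_C] at hev
    rw [hC, hev] at hH
    simp at hH
  | succ m =>
    obtain ⟨a, G, hG, rfl⟩ := hHm.exists_eq_add_sum
    have ha : IsUnit a := by
      rw [← IsLocalRing.residue_ne_zero_iff_isUnit]
      simpa [hψX, hψY, hψC] using hH
    simp only [map_add, map_mul, map_sum, map_pow, eval_C, eval_X] at hev
    have hy : z (Fin.last s) ^ (m + 1) ∈
        Ideal.span (Set.range fun i : Fin s => z i.castSucc) * Ideal.span (Set.range z) ^ m := by
      rw [← Ideal.unit_mul_mem_iff_mem _ ha, eq_neg_of_add_eq_zero_left hev]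
      refine (Ideal.neg_mem_iff _).mpr (Ideal.sum_mem _ fun i _ =>
        Ideal.mul_mem_mul (Ideal.subset_span ⟨i, rfl⟩) ?_)
      exact (Ideal.mem_span_pow_iff_exists_isHomogeneous z _).mpr ⟨_, hG i, rfl⟩
    refine lt_of_le_of_lt (Nat.sInf_le (m := m) ?_) hm
    rw [Set.mem_ofPred_eq]
    rw [span_range_eq_sup z] at hy ⊢
    rw [sup_span_singleton_pow_succ]
    exact sup_eq_left.mpr ((Ideal.span_singleton_le_iff_mem _).mpr hy)

end Equations

/-! ### The relation type and the top-degree equation -/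

theorem mainTheorem4 {R : Type*} [CommRing R] [IsLocalRing R] [IsNoetherianRing R]
    {s : ℕ} (x : Fin s → R) (y : R) (I J : Ideal R)
    (z : Fin (s + 1) → R) (hz : z = Fin.snoc (α := fun _ => R) x y)
    (hI : IsMinimalGeneratingFamily z I)
    (hJ : J = Ideal.span (Set.range x))
    (hred : IsReduction J I)
    (r : ℕ) (hr : r = reductionNumber J I)
    (ha : IsDSequence x)
    (hb : ∀ i : ℕ, 1 ≤ i → i < s →
      Subsingleton (ValabregaVallaModule (initialIdeal x i) I (r + 1))) :
    relationType z ≤ (r + 1 : ℕ) ∧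
    (RingTheory.Sequence.IsRegular R (List.ofFn x) →
      (∀ i : ℕ, 1 ≤ i → i < s →
        Subsingleton (ValabregaVallaModule (initialIdeal x i) I r)) →
      relationType z = (r + 1 : ℕ) ∧
      ∃ F : Fin s → MvPolynomial (Fin (s + 1)) R,
        (∀ i, (F i).IsHomogeneous r) ∧
        (MvPolynomial.X (Fin.last s) ^ (r + 1)
          - ∑ i : Fin s, MvPolynomial.X i.castSucc * F i).IsHomogeneous (r + 1) ∧
        MvPolynomial.X (Fin.last s) ^ (r + 1)
          - ∑ i : Fin s, MvPolynomial.X i.castSucc * F i ∈ reesEquations z ∧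
        reesEquations z =
          Ideal.span {MvPolynomial.X (Fin.last s) ^ (r + 1)
            - ∑ i : Fin s, MvPolynomial.X i.castSucc * F i} ⊔ reesEquationsUpTo z r) := by
  subst hz
  set z : Fin (s + 1) → R := Fin.snoc (α := fun _ => R) x y with hz
  have hx : x = fun i : Fin s => z i.castSucc := by ext i; simp [hz]
  clear_value z
  subst hx hJ
  obtain rfl : Ideal.span (Set.range z) = I := hI.span_range
  set I := Ideal.span (Set.range z) with hIdef
  set x : Fin s → R := fun i => z i.castSucc with hxdef
  have hredr : I ^ (r + 1) = Ideal.span (Set.range x) * I ^ r := by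
    rw [hr]
    exact Nat.sInf_mem (s := {n : ℕ | I ^ (n + 1) = Ideal.span (Set.range x) * I ^ n}) hred.2
  -- If `r = 0` then `I = J`, making `y` redundant.
  have hr1 : 1 ≤ r := by
    by_contra! h0
    obtain rfl : r = 0 := by omega
    refine hI.notMem_span (Fin.last s) ?_
    have himage : z '' {j | j ≠ Fin.last s} = Set.range x := by
      ext a
      simp [hxdef, Fin.exists_fin_succ', Fin.castSucc_ne_last]
    rw [himage]
    simp only [zero_add, pow_one, pow_zero, Ideal.one_eq_top, Ideal.mul_top] at hredr
    rw [← hredr]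
    exact Ideal.subset_span ⟨_, rfl⟩
  have hb' : ∀ i : ℕ, 1 ≤ i → i < s →
      initialIdeal x i ⊓ I ^ (r + 1) ≤ initialIdeal x i * I ^ r := fun i h1 hs =>
    subsingleton_valabregaVallaModule_iff.mp (hb i h1 hs)
  obtain ⟨F, hF, hFhom, hFQ⟩ := exists_pow_sub_sum_mem_reesEquations hredr
  have hQ : reesEquations z = reesEquationsUpTo z (r + 1) := by
    refine le_antisymm (reesEquations_le_upTo fun n hn G hG hGQ => ?_) (reesEquationsUpTo_le z _)
    refine (sup_le ?_ le_rfl : _ ⊔ reesEquationsUpTo z n ≤ reesEquationsUpTo z n)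
      (mem_span_sup_reesEquationsUpTo (by omega) (by omega) (fun k w hw hkw =>
        colon_condition_of_le ha hred.1 hredr hb' hn k hw hkw) hF hFQ hG hGQ)
    rw [Ideal.span_singleton_le_iff_mem]
    exact hFhom.mem_reesEquationsUpTo hn hFQ
  have hle : relationType z ≤ (r + 1 : ℕ) := sInf_le ⟨r + 1, rfl, by omega, hQ⟩
  refine ⟨hle, fun hreg hd => ⟨le_antisymm hle (le_sInf ?_), F, hF, hFhom, hFQ, ?_⟩⟩
  · rintro _ ⟨n, rfl, -, hn⟩
    rw [hn] at hFQ
    have := lt_of_pow_sub_sum_mem_reesEquationsUpTo hFQ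
    rw [← hxdef, ← hIdef, ← hr] at this
    exact_mod_cast this
  · have hcolon : ∀ k : Fin s, ∀ w ∈ I ^ r, z k.castSucc * w ∈ initialIdeal x k →
        w ∈ initialIdeal x k * I ^ (r - 1) := by
      intro k w hw hkw
      have hwk := mem_initialIdeal_of_mul_mem_of_isWeaklyRegular hreg.toIsWeaklyRegular k hkw
      -- Hypothesis (d) starts at `J_1`; for `J_0 = 0` the element is zero.
      rcases Nat.eq_zero_or_pos (k : ℕ) with h0 | h0
      · rw [h0, initialIdeal_zero] at hwk
        rw [(Submodule.mem_bot R).mp hwk]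
        exact Ideal.zero_mem _
      · exact subsingleton_valabregaVallaModule_iff.mp (hd k h0 k.2) ⟨hwk, hw⟩
    refine le_antisymm ?_ (sup_le ((Ideal.span_singleton_le_iff_mem _).mpr hFQ)
      (reesEquationsUpTo_le z r))
    rw [hQ]
    refine Ideal.span_le.mpr ?_
    rintro G ⟨hGQ, m, hm, hGm⟩
    rcases Nat.lt_or_ge r m with h | h
    · obtain rfl : m = r + 1 := by omega
      exact mem_span_sup_reesEquationsUpTo hr1 le_rfl hcolon hF hFQ hGm hGQ
    · exact Ideal.mem_sup_right (hGm.mem_reesEquationsUpTo h hGQ)
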